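/- Let $n\ge 0$ and let $B_n$ be the braid group on $n$ strands, generated by the band generators $a_{ij}$ ($1\le i<j\le n$) with the Birman–Ko–Lee relations $$a_{jk}a_{ij}=a_{ij}a_{ik}=a_{ik}a_{jk}\quad(i<j<k),\qquad a_{ij}a_{kl}=a_{kl}a_{ij},\quad a_{il}a_{jk}=a_{jk}a_{il}\quad(i<j<k<l).$$ Let $B_n^+$ be the submonoid generated by the $a_{ij}$, and write $V\le W$ if $W=PVQ$ with $P,Q\in B_n^+$. Let $\delta=a_{n-1,n}\cdots a_{2,3}a_{1,2}$ and let $\mathrm{CnFct}(B_n)=\{W\in B_n: e\le W\le\delta\}$ be the set of canonical factors. For canonical factors $A,B$ write $A\prec B$ if $AQ=B$ for some canonical factor $Q$. Place punctures $P_1,\dots,P_n$ counterclockwise, equally spaced, on a circle in $\mathbb C$, with $P_n$ and $P_1$ separated by the half-line from the centre of angle $\pi$. A diagram is a non-crossing partition of $\{P_1,\dots,P_n\}$. A block $\{P_{s_1},\dots,P_{s_k}\}$ with $s_1<\dots<s_k$ and $k\ge 2$ is drawn as the convex $k$-gon (an edge, if $k=2$) with these vertices and represents the braid $a_{s_{k-1}s_k}\cdots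 a_{s_2s_3}a_{s_1s_2}$; a block with one element represents $e$. A diagram represents the product of the (pairwise commuting) braids of its blocks. **Theorem.** Every canonical factor $A\in\mathrm{CnFct}(B_n)$ is represented by exactly one diagram. Let $\mathrm{cvh}(A)\subset\mathbb C$ denote the union of the convex hulls of the blocks with at least two elements of that diagram. Then for all $A,B\in\mathrm{CnFct}(B_n)$, $$\mathrm{cvh}(A)\subseteq\mathrm{cvh}(B)\iff A\prec B.$$ -/

import Mathlib

namespace BandBraid

/-- Index set of the band generators `a_{ij}`, `i < j`. Strands are numbered `0, …, n - 1`. -/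
abbrev BandIndex (n : ℕ) : Type := {p : Fin n × Fin n // p.1 < p.2}

/-- The letter `a_{ij}` (`i < j`) in the free group on the band generators. -/
def letter {n : ℕ} (i j : Fin n) (h : i < j) : FreeGroup (BandIndex n) :=
  FreeGroup.of ⟨(i, j), h⟩

/-- The Birman–Ko–Lee relators: `a_{jk} a_{ij} = a_{ij} a_{ik} = a_{ik} a_{jk}` for `i < j < k`,
and, for `i < j < k < l`, the commutation of `a_{ij}` with `a_{kl}` and of `a_{il}` with `a_{jk}`
(generators whose chords are disjoint commute). -/
def relators (n : ℕ) : Set (FreeGroup (BandIndex n)) :=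
  {r | ∃ (i j k : Fin n) (hij : i < j) (hjk : j < k),
      r = (letter j k hjk * letter i j hij) *
            (letter i j hij * letter i k (hij.trans hjk))⁻¹ ∨
      r = (letter i j hij * letter i k (hij.trans hjk)) *
            (letter i k (hij.trans hjk) * letter j k hjk)⁻¹} ∪
  {r | ∃ (i j k l : Fin n) (hij : i < j) (hjk : j < k) (hkl : k < l),
      r = (letter i j hij * letter k l hkl) * (letter k l hkl * letter i j hij)⁻¹ ∨
      r = (letter i l (hij.trans (hjk.trans hkl)) * letter j k hjk) *
            (letter j k hjk * letter i l (hij.trans (hjk.trans hkl)))⁻¹}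

/-- The braid group `B_n`, in the band generator (Birman–Ko–Lee) presentation. -/
abbrev Braid (n : ℕ) : Type := PresentedGroup (relators n)

/-- The band generator `a_{ij} ∈ B_n` for `i < j` (and, by convention, `1` otherwise). -/
def band {n : ℕ} (i j : Fin n) : Braid n :=
  if h : i < j then PresentedGroup.of (rels := relators n) ⟨(i, j), h⟩ else 1

/-- The monoid `B_n^+` of positive braids: products of band generators. -/
def positive (n : ℕ) : Submonoid (Braid n) :=
  Submonoid.closure {b | ∃ i j : Fin n, i < j ∧ b = band i j}

/-- `V ≤ W` : `W = P V Q` for some positive `P`, `Q`. -/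
def BLe {n : ℕ} (V W : Braid n) : Prop :=
  ∃ P ∈ positive n, ∃ Q ∈ positive n, W = P * V * Q

/-- The braid of the polygon with vertex set `S = {s_1 < ⋯ < s_k}`: the product
`a_{s_{k-1} s_k} ⋯ a_{s_2 s_3} a_{s_1 s_2}` of `k - 1` consecutive edges read clockwise (the
punctures are numbered counterclockwise). It is `1` if `S` has at most one element. -/
def polygonBraid {n : ℕ} (S : Finset (Fin n)) : Braid n :=
  (List.zipWith (fun j i => band i j) (S.sort (· ≥ ·)) (S.sort (· ≥ ·)).tail).prod

/-- The fundamental element `δ = a_{n-1,n} ⋯ a_{2,3} a_{1,2}`, the braid of the full `n`-gon. -/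
def delta (n : ℕ) : Braid n := polygonBraid Finset.univ

/-- The set of canonical factors `{W ∈ B_n | e ≤ W ≤ δ}`. -/
def CnFct (n : ℕ) : Set (Braid n) := {W | BLe 1 W ∧ BLe W (delta n)}

/-- `A ≺ B` : `A Q = B` for some canonical factor `Q`. -/
def Prec {n : ℕ} (A B : Braid n) : Prop := ∃ Q ∈ CnFct n, A * Q = B

/-- A non-crossing partition diagram on `n` punctures: a partition of the punctures such that no two
different blocks cross. The blocks with at least two elements are the (vertex sets of the) pairwise
disjoint polygons of the diagram; the other blocks are the isolated dots. -/
@[ext]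
structure Diagram (n : ℕ) where
  /-- the partition -/
  partition : Finpartition (Finset.univ : Finset (Fin n))
  /-- different blocks do not cross -/
  nonCrossing : ∀ S ∈ partition.parts, ∀ T ∈ partition.parts, ∀ a b c d : Fin n,
    a < b → b < c → c < d → a ∈ S → c ∈ S → b ∈ T → d ∈ T → S = T

/-- `n` punctures on the circle of radius `1/2`, equally spaced and numbered counterclockwise, the
first and the last one being separated by the half-line of angle `π`. -/
noncomputable def puncture {n : ℕ} (k : Fin n) : ℂ :=
  (1 / 2 : ℂ) *
    Complex.exp (((-Real.pi + (2 * (k : ℝ) + 1) * Real.pi / (n : ℝ) : ℝ) : ℂ) * Complex.I)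

/-- `cvh`: the union of the (filled, closed) polygons of the diagram; a block with two elements
contributes an edge and isolated dots contribute nothing. -/
def Diagram.cvh {n : ℕ} (D : Diagram n) : Set ℂ :=
  ⋃ S ∈ {S | S ∈ D.partition.parts ∧ 2 ≤ S.card}, convexHull ℝ (puncture '' (S : Set (Fin n)))

theorem relator_eq {n : ℕ} {x y : FreeGroup (BandIndex n)} (h : x * y⁻¹ ∈ relators n) :
    PresentedGroup.mk (relators n) x = PresentedGroup.mk (relators n) y :=
  PresentedGroup.mk_eq_mk_of_mul_inv_mem h

theorem band_comm_disjoint {n : ℕ} {i j k l : Fin n} (hij : i < j) (hjk : j < k) (hkl : k < l) :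
    Commute (band i j) (band k l) := by
  have h := relator_eq (n := n) (Or.inr ⟨i, j, k, l, hij, hjk, hkl, Or.inl rfl⟩)
  simp only [map_mul] at h
  simp only [band, hij, hkl, dif_pos]
  exact h

theorem band_comm_nested {n : ℕ} {i j k l : Fin n} (hij : i < j) (hjk : j < k) (hkl : k < l) :
    Commute (band i l) (band j k) := by
  have h := relator_eq (n := n) (Or.inr ⟨i, j, k, l, hij, hjk, hkl, Or.inr rfl⟩)
  simp only [map_mul] at h
  simp only [band, hjk, hij.trans (hjk.trans hkl), dif_pos]
  exact h

theorem mem_polygon {n : ℕ} {S : Finset (Fin n)} {x : Braid n}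
    (hx : x ∈ List.zipWith (fun j i => band i j) (S.sort (· ≥ ·)) (S.sort (· ≥ ·)).tail) :
    ∃ i ∈ S, ∃ j ∈ S, x = band i j := by
  obtain ⟨m, hm, rfl⟩ := List.mem_iff_getElem.1 hx
  rw [List.getElem_zipWith]
  exact ⟨_, (Finset.mem_sort _).1 (List.mem_of_mem_tail (List.getElem_mem _)), _,
    (Finset.mem_sort _).1 (List.getElem_mem _), rfl⟩

/-- The braids of two different blocks of a diagram commute, so that their product over all blocks
does not depend on the order. -/
theorem Diagram.commute {n : ℕ} (D : Diagram n) :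
    (D.partition.parts : Set (Finset (Fin n))).Pairwise
      (Function.onFun Commute polygonBraid) := by
  intro S hS T hT hST
  refine Commute.list_prod_left _ _ fun x hx => Commute.list_prod_right _ _ fun y hy => ?_
  obtain ⟨i, hi, j, hj, rfl⟩ := mem_polygon hx
  obtain ⟨k, hk, l, hl, rfl⟩ := mem_polygon hy
  by_cases hij : i < j
  swap
  · simp [band, hij]
  by_cases hkl : k < l
  swap
  · simp [band, hkl]
  have hne : ∀ a ∈ S, ∀ b ∈ T, a ≠ b := fun a ha b hb hab =>
    Finset.disjoint_left.1 (D.partition.disjoint hS hT hST) ha (hab ▸ hb)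
  have h1 := D.nonCrossing S hS T hT i k j l
  have h2 := D.nonCrossing T hT S hS k i l j
  rcases lt_or_gt_of_ne (hne i hi k hk) with a | a <;>
    rcases lt_or_gt_of_ne (hne j hj l hl) with b | b <;>
    rcases lt_or_gt_of_ne (hne i hi l hl) with c | c <;>
    rcases lt_or_gt_of_ne (hne j hj k hk) with d | d
  all_goals first
    | exact band_comm_disjoint hij d hkl
    | exact (band_comm_disjoint hkl c hij).symm
    | exact band_comm_nested a hkl b
    | exact (band_comm_nested a hij b).symm
    | exact absurd (h1 a d b hi hj hk hl) hST
    | exact absurd (h2 a c b hk hl hi hj).symm hST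

/-- The braid represented by a diagram: the product of the braids of its polygons. -/
def Diagram.braid {n : ℕ} (D : Diagram n) : Braid n :=
  D.partition.parts.noncommProd polygonBraid D.commute

end BandBraid

namespace BandBraid

variable {n : ℕ}

/-! Everything takes place in the group, and only two invariants of a braid are used: its
permutation and its exponent sum. A diagram with `m` blocks has exponent sum `n - m`, and its
permutation is transitive on each block.

The key is a rigidity statement, `Diagram.eq_of_mem_word`. Let `w` be a positive word for a diagram.
Functions on the punctures that agree at the two ends of every letter of `w` are invariant under the
permutation, hence constant on blocks. There are `n - m` letters, so these functions form a space of
dimension at least `m`, which is therefore the whole space of block functions. Thus every letter is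
a chord inside a block.

The relations allow such a chord to be split off on either side, cutting its polygon in two
(`Diagram.exists_split_left`, `Diagram.exists_split_right`). As `δ` is a diagram, stripping letters
from both ends shows that every canonical factor is one. Rigidity also shows that `D.braid * Q =
E.braid` with `Q` positive forces `D` to refine `E`, which gives uniqueness. Conversely, a
refinement is reached by successive cuts (`Diagram.exists_split_of_lt`). Finally, hulls of different
blocks are disjoint, so by connectedness inclusion of the `cvh` is refinement. -/

theorem band_of_lt {i j : Fin n} (h : i < j) :
    band i j = PresentedGroup.of (rels := relators n) ⟨(i, j), h⟩ := dif_pos h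

theorem band_mul_band_left {i j k : Fin n} (hij : i < j) (hjk : j < k) :
    band j k * band i j = band i j * band i k := by
  have h := relator_eq (n := n) (Or.inl ⟨i, j, k, hij, hjk, Or.inl rfl⟩)
  simp only [map_mul] at h
  simp only [band, hij, hjk, hij.trans hjk, dif_pos]
  exact h

theorem band_mul_band_right {i j k : Fin n} (hij : i < j) (hjk : j < k) :
    band i j * band i k = band i k * band j k := by
  have h := relator_eq (n := n) (Or.inl ⟨i, j, k, hij, hjk, Or.inr rfl⟩)
  simp only [map_mul] at h
  simp only [band, hij, hjk, hij.trans hjk, dif_pos]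
  exact h

/-- Chords that do not meet give commuting band generators: the disjoint case, without
restrictions on the order of the end points of each chord. -/
theorem commute_band_of_lt {i j k l : Fin n} (hjk : j < k) : Commute (band i j) (band k l) := by
  by_cases hij : i < j
  · by_cases hkl : k < l
    · exact band_comm_disjoint hij hjk hkl
    · simp [band, hkl]
  · simp [band, hij]

theorem commute_band_of_nested {i j k l : Fin n} (hij : i < j) (hkl : k < l) :
    Commute (band i l) (band j k) := by
  by_cases hjk : j < k
  · exact band_comm_nested hij hjk hkl
  · simp [band, hjk]

/-! ### Cutting a polygon along a chord -/

/-- The product of the band generators of consecutive entries of a (descending) list. -/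
def chainBraid (l : List (Fin n)) : Braid n := (List.zipWith (fun j i => band i j) l l.tail).prod

theorem polygonBraid_eq (S : Finset (Fin n)) : polygonBraid S = chainBraid (S.sort (· ≥ ·)) := rfl

@[simp] theorem chainBraid_nil : chainBraid ([] : List (Fin n)) = 1 := rfl

@[simp] theorem chainBraid_singleton (i : Fin n) : chainBraid [i] = 1 := rfl

theorem chainBraid_cons_cons (i j : Fin n) (l : List (Fin n)) :
    chainBraid (j :: i :: l) = band i j * chainBraid (i :: l) := by
  simp [chainBraid]

theorem chainBraid_append (l₁ l₂ : List (Fin n)) (x : Fin n) :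
    chainBraid (l₁ ++ x :: l₂) = chainBraid (l₁ ++ [x]) * chainBraid (x :: l₂) := by
  induction l₁ with
  | nil => simp
  | cons a l₁ ih =>
    cases l₁ with
    | nil => simp [chainBraid_cons_cons]
    | cons b l₁ => simpa [chainBraid_cons_cons, mul_assoc] using ih

theorem commute_chainBraid {x : Braid n} {l : List (Fin n)}
    (h : ∀ a ∈ l, ∀ b ∈ l, Commute x (band a b)) : Commute x (chainBraid l) := by
  induction l with
  | nil => simp
  | cons a l ih =>
    cases l with
    | nil => simp
    | cons b l =>
      rw [chainBraid_cons_cons]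
      exact (h _ (by simp) _ (by simp)).mul_right
        (ih fun c hc d hd => h c (List.mem_cons_of_mem _ hc) d (List.mem_cons_of_mem _ hd))

/-- A polygon, with the long edge `a_{ij}` split off on the right. -/
theorem chainBraid_eq_mul_band {i j : Fin n} {M : List (Fin n)}
    (h : (j :: (M ++ [i])).Pairwise (· > ·)) :
    chainBraid (j :: (M ++ [i])) = chainBraid (M ++ [i]) * band i j := by
  induction M generalizing j with
  | nil => simp [chainBraid_cons_cons]
  | cons m M ih =>
    have hm := (List.pairwise_cons.1 h).2
    have hjm : m < j := (List.pairwise_cons.1 h).1 m (by simp)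
    have him : i < m := (List.pairwise_cons.1 hm).1 i (by simp)
    have hc : Commute (band m j) (chainBraid (M ++ [i])) :=
      commute_chainBraid fun a _ b hb =>
        (commute_band_of_lt ((List.pairwise_cons.1 hm).1 b hb)).symm
    rw [List.cons_append, chainBraid_cons_cons, ih hm, ← mul_assoc, hc.eq, mul_assoc,
      band_mul_band_left him hjm, mul_assoc]

/-- A polygon, with the long edge `a_{ij}` split off on the left. -/
theorem chainBraid_eq_band_mul {i j : Fin n} {M : List (Fin n)}
    (h : (j :: (M ++ [i])).Pairwise (· > ·)) :
    chainBraid (j :: (M ++ [i])) = band i j * chainBraid (j :: M) := by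
  induction M generalizing j with
  | nil => simp [chainBraid_cons_cons]
  | cons m M ih =>
    have hm := (List.pairwise_cons.1 h).2
    have hjm : m < j := (List.pairwise_cons.1 h).1 m (by simp)
    have him : i < m := (List.pairwise_cons.1 hm).1 i (by simp)
    rw [List.cons_append, chainBraid_cons_cons, ih hm, chainBraid_cons_cons, ← mul_assoc,
      ← mul_assoc, band_mul_band_left him hjm, band_mul_band_right him hjm]

/-- Only the first edge, from `i` to its successor `l`, fails to commute with `a_{ij}`; the triangle
relation on `l < i < j` moves its end from `i` to `j`. `chainBraid_mul_band` is the mirror image for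
the last edge. -/
theorem band_mul_chainBraid {i j : Fin n} {L : List (Fin n)} (hij : i < j)
    (h : (i :: L).Pairwise (· > ·)) :
    band i j * chainBraid (i :: L) = chainBraid (j :: L) * band i j := by
  cases L with
  | nil => simp
  | cons l L =>
    have hl : l < i := (List.pairwise_cons.1 h).1 l (by simp)
    have hc : Commute (band i j) (chainBraid (l :: L)) :=
      commute_chainBraid fun a _ b hb =>
        (commute_band_of_lt ((List.pairwise_cons.1 h).1 b hb)).symm
    rw [chainBraid_cons_cons, chainBraid_cons_cons, ← mul_assoc, band_mul_band_left hl hij,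
      band_mul_band_right hl hij, mul_assoc, hc.eq, mul_assoc]

theorem chainBraid_mul_band {i j : Fin n} {U : List (Fin n)} (hij : i < j)
    (h : (U ++ [j]).Pairwise (· > ·)) :
    chainBraid (U ++ [j]) * band i j = band i j * chainBraid (U ++ [i]) := by
  induction U using List.reverseRecOn with
  | nil => simp
  | append_singleton U u _ =>
    rw [List.pairwise_append] at h
    have hu : j < u := h.2.2 u (by simp) j (by simp)
    have hc : Commute (band i j) (chainBraid (U ++ [u])) :=
      commute_chainBraid fun a ha b _ => commute_band_of_lt (h.2.2 a ha j (by simp))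
    simp only [List.append_assoc, List.singleton_append]
    rw [chainBraid_append, chainBraid_append U [i], chainBraid_cons_cons, chainBraid_cons_cons,
      chainBraid_singleton, chainBraid_singleton, mul_one, mul_one, mul_assoc,
      band_mul_band_left hij hu, ← mul_assoc, ← mul_assoc, hc.eq]

/-- With `a_{ij}` split off on the right, the vertices between `i` and `j` keep `i`, and the others
keep `j`. On the left, in `chainBraid_split_left`, the two ends change roles. -/
theorem chainBraid_split_right {i j : Fin n} {U M L : List (Fin n)}
    (h : (U ++ j :: (M ++ i :: L)).Pairwise (· > ·)) :
    chainBraid (U ++ j :: (M ++ i :: L)) =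
      chainBraid (U ++ j :: L) * chainBraid (M ++ [i]) * band i j := by
  simp only [List.pairwise_append, List.pairwise_cons, List.mem_cons, List.mem_append] at h
  obtain ⟨-, ⟨hj, hM, ⟨hi, hL⟩, hMi⟩, -⟩ := h
  have hij : i < j := hj i (by simp)
  have hc : Commute (chainBraid (j :: L)) (chainBraid (M ++ [i])) := by
    refine commute_chainBraid fun a ha b hb => (commute_chainBraid fun c hc d hd => ?_).symm
    have hb' : b < j := by
      rcases List.mem_append.1 hb with hb | hb
      · exact hj b (by simp [hb])
      · rw [List.mem_singleton.1 hb]; exact hij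
    have ha' : ∀ x ∈ L, x < a := by
      intro x hx
      rcases List.mem_append.1 ha with ha | ha
      · exact hMi a ha x (by simp [hx])
      · rw [List.mem_singleton.1 ha]; exact hi x hx
    rcases List.mem_cons.1 hc with rfl | hcL
    · exact commute_band_of_lt hb'
    · rcases List.mem_cons.1 hd with rfl | hd
      · exact (commute_band_of_nested (ha' c hcL) hb').symm
      · exact (commute_band_of_lt (ha' d hd)).symm
  have h1 : (j :: (M ++ [i])).Pairwise (· > ·) := by
    simp only [List.pairwise_append, List.pairwise_cons]
    refine ⟨fun a ha => hj a ?_, hM, by simp, fun a ha b hb => hMi a ha b ?_⟩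
    · rcases List.mem_append.1 ha with ha | ha
      · exact .inl ha
      · exact .inr (.inl (List.mem_singleton.1 ha))
    · exact .inl (List.mem_singleton.1 hb)
  have h2 : (i :: L).Pairwise (· > ·) := List.pairwise_cons.2 ⟨hi, hL⟩
  calc chainBraid (U ++ j :: (M ++ i :: L))
      = chainBraid (U ++ [j]) * (chainBraid (j :: (M ++ [i])) * chainBraid (i :: L)) := by
        rw [chainBraid_append, ← List.cons_append, chainBraid_append (j :: M)]; rfl
    _ = chainBraid (U ++ [j]) * (chainBraid (M ++ [i]) * (chainBraid (j :: L) * band i j)) := by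
        rw [chainBraid_eq_mul_band h1, mul_assoc, band_mul_chainBraid hij h2]
    _ = _ := by
        rw [chainBraid_append U L]
        simp only [mul_assoc]
        rw [← mul_assoc (chainBraid (M ++ [i])), ← hc.eq]
        simp only [mul_assoc]

theorem chainBraid_split_left {i j : Fin n} {U M L : List (Fin n)}
    (h : (U ++ j :: (M ++ i :: L)).Pairwise (· > ·)) :
    chainBraid (U ++ j :: (M ++ i :: L)) =
      band i j * (chainBraid (U ++ i :: L) * chainBraid (j :: M)) := by
  simp only [List.pairwise_append, List.pairwise_cons, List.mem_cons, List.mem_append] at h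
  obtain ⟨hU, ⟨hj, hM, ⟨hi, hL⟩, hMi⟩, hUj⟩ := h
  have hij : i < j := hj i (by simp)
  have hc : Commute (chainBraid (i :: L)) (chainBraid (j :: M)) := by
    refine commute_chainBraid fun a ha b hb => (commute_chainBraid fun c hc d hd => ?_).symm
    refine (commute_band_of_lt (lt_of_le_of_lt (b := i) ?_ ?_)).symm
    · rcases List.mem_cons.1 hd with rfl | hd
      · exact le_rfl
      · exact (hi d hd).le
    · rcases List.mem_cons.1 ha with rfl | ha
      · exact hij
      · exact hMi a ha i (by simp)
  have h1 : (j :: (M ++ [i])).Pairwise (· > ·) := by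
    simp only [List.pairwise_append, List.pairwise_cons]
    refine ⟨fun a ha => hj a ?_, hM, by simp, fun a ha b hb => hMi a ha b ?_⟩
    · rcases List.mem_append.1 ha with ha | ha
      · exact .inl ha
      · exact .inr (.inl (List.mem_singleton.1 ha))
    · exact .inl (List.mem_singleton.1 hb)
  have h2 : (U ++ [j]).Pairwise (· > ·) := by
    simp only [List.pairwise_append]
    exact ⟨hU, by simp, fun a ha b hb => hUj a ha b (.inl (List.mem_singleton.1 hb))⟩
  calc chainBraid (U ++ j :: (M ++ i :: L))
      = chainBraid (U ++ [j]) * (chainBraid (j :: (M ++ [i])) * chainBraid (i :: L)) := by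
        rw [chainBraid_append, ← List.cons_append, chainBraid_append (j :: M)]; rfl
    _ = (chainBraid (U ++ [j]) * band i j) * (chainBraid (j :: M) * chainBraid (i :: L)) := by
        rw [chainBraid_eq_band_mul h1]; simp only [mul_assoc]
    _ = _ := by
        rw [chainBraid_mul_band hij h2, ← hc.eq, chainBraid_append U L]
        simp only [mul_assoc]

theorem polygonBraid_toFinset {l : List (Fin n)} (h : l.Pairwise (· > ·)) :
    polygonBraid l.toFinset = chainBraid l := by
  rw [polygonBraid_eq, (List.toFinset_sort (· ≥ ·) (h.imp fun h => ne_of_gt h)).2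
    (h.imp fun h => le_of_lt h)]

theorem exists_sort_eq {T : Finset (Fin n)} {i j : Fin n} (hi : i ∈ T) (hj : j ∈ T) (hij : i < j) :
    ∃ U M L : List (Fin n), (U ++ j :: (M ++ i :: L)).Pairwise (· > ·) ∧
      (U ++ j :: (M ++ i :: L)).toFinset = T := by
  have hs : (T.sort (· ≥ ·)).Pairwise (· > ·) := (T.sortedGT_sort).pairwise
  have hT := T.sort_toFinset (· ≥ ·)
  obtain ⟨U, R, hR⟩ := List.append_of_mem ((Finset.mem_sort (· ≥ ·)).2 hj)
  have hi' : i ∈ R := by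
    have := (Finset.mem_sort (· ≥ ·)).2 hi
    rw [hR] at this hs
    rw [List.pairwise_append] at hs
    rcases List.mem_append.1 this with h | h
    · exact absurd (hs.2.2 i h j (by simp)) (not_lt.2 hij.le)
    · exact (List.mem_cons.1 h).resolve_left hij.ne
  obtain ⟨M, L, rfl⟩ := List.append_of_mem hi'
  exact ⟨U, M, L, hR ▸ hs, hR ▸ hT⟩

theorem polygonBraid_split_right {T : Finset (Fin n)} {i j : Fin n} (hi : i ∈ T) (hj : j ∈ T)
    (hij : i < j) :
    polygonBraid T = polygonBraid (T.filter fun t => ¬(i ≤ t ∧ t < j)) *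
      polygonBraid (T.filter fun t => i ≤ t ∧ t < j) * band i j := by
  obtain ⟨U, M, L, h, rfl⟩ := exists_sort_eq hi hj hij
  rw [polygonBraid_toFinset h, chainBraid_split_right h]
  simp only [List.pairwise_append, List.pairwise_cons, List.mem_cons, List.mem_append] at h
  obtain ⟨hU, ⟨hjl, hM, ⟨hil, hL⟩, hMi⟩, hUj⟩ := h
  have h1 : (U ++ j :: L).Pairwise (· > ·) := by
    simp only [List.pairwise_append, List.pairwise_cons, List.mem_cons]
    exact ⟨hU, ⟨fun a ha => hjl a (by simp [ha]), hL⟩, fun a ha b hb => hUj a ha b (by tauto)⟩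
  have h2 : (M ++ [i]).Pairwise (· > ·) := by
    simp only [List.pairwise_append, List.mem_singleton]
    exact ⟨hM, by simp, fun a ha b hb => hMi a ha b (by tauto)⟩
  rw [← polygonBraid_toFinset h1, ← polygonBraid_toFinset h2]
  congr 3 <;> ext t <;>
    simp only [List.mem_toFinset, List.mem_append, List.mem_cons, Finset.mem_filter,
      List.not_mem_nil, or_false]
  · have e1 : t ∈ U → t > j := fun h => hUj t h j (.inl rfl)
    have e2 : t ∈ L → t < i := fun h => hil t h
    have e3 : t ∈ M → t > i := fun h => hMi t h i (.inl rfl)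
    have e4 : t ∈ M → t < j := fun h => hjl t (.inl h)
    grind
  · have e1 : t ∈ U → t > j := fun h => hUj t h j (.inl rfl)
    have e2 : t ∈ L → t < i := fun h => hil t h
    have e3 : t ∈ M → t > i := fun h => hMi t h i (.inl rfl)
    have e4 : t ∈ M → t < j := fun h => hjl t (.inl h)
    grind

theorem polygonBraid_split_left {T : Finset (Fin n)} {i j : Fin n} (hi : i ∈ T) (hj : j ∈ T)
    (hij : i < j) :
    polygonBraid T = band i j * (polygonBraid (T.filter fun t => ¬(i < t ∧ t ≤ j)) *
      polygonBraid (T.filter fun t => i < t ∧ t ≤ j)) := by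
  obtain ⟨U, M, L, h, rfl⟩ := exists_sort_eq hi hj hij
  rw [polygonBraid_toFinset h, chainBraid_split_left h]
  simp only [List.pairwise_append, List.pairwise_cons, List.mem_cons, List.mem_append] at h
  obtain ⟨hU, ⟨hjl, hM, ⟨hil, hL⟩, hMi⟩, hUj⟩ := h
  have h1 : (U ++ i :: L).Pairwise (· > ·) := by
    simp only [List.pairwise_append, List.pairwise_cons, List.mem_cons]
    exact ⟨hU, ⟨fun a ha => hil a ha, hL⟩, fun a ha b hb => hUj a ha b (by tauto)⟩
  have h2 : (j :: M).Pairwise (· > ·) :=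
    List.pairwise_cons.2 ⟨fun a ha => hjl a (.inl ha), hM⟩
  rw [← polygonBraid_toFinset h1, ← polygonBraid_toFinset h2]
  congr 3 <;> ext t <;>
    simp only [List.mem_toFinset, List.mem_append, List.mem_cons, Finset.mem_filter]
  · have e1 : t ∈ U → t > j := fun h => hUj t h j (.inl rfl)
    have e2 : t ∈ L → t < i := fun h => hil t h
    have e3 : t ∈ M → t > i := fun h => hMi t h i (.inl rfl)
    have e4 : t ∈ M → t < j := fun h => hjl t (.inl h)
    grind
  · have e1 : t ∈ U → t > j := fun h => hUj t h j (.inl rfl)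
    have e2 : t ∈ L → t < i := fun h => hil t h
    have e3 : t ∈ M → t > i := fun h => hMi t h i (.inl rfl)
    have e4 : t ∈ M → t < j := fun h => hjl t (.inl h)
    grind

/-! ### Cutting a block of a diagram -/

/-- Splitting a block of a diagram into two parts that do not cross. -/
theorem Diagram.exists_split (D : Diagram n) {S : Finset (Fin n)} (hS : S ∈ D.partition.parts)
    (p : Fin n → Prop) [DecidablePred p] (hp : ∃ t ∈ S, p t) (hnp : ∃ t ∈ S, ¬p t)
    (hcross : ∀ a b c d : Fin n, a < b → b < c → c < d →
      ¬(p a ∧ ¬p b ∧ p c ∧ ¬p d) ∧ ¬(¬p a ∧ p b ∧ ¬p c ∧ p d)) :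
    ∃ E : Diagram n,
      E.partition.parts =
        insert (S.filter fun t => ¬p t) (insert (S.filter p) (D.partition.parts.erase S)) ∧
      ∃ R : Braid n, D.braid = polygonBraid S * R ∧ D.braid = R * polygonBraid S ∧
        E.braid = polygonBraid (S.filter fun t => ¬p t) * polygonBraid (S.filter p) * R ∧
        E.braid = R * (polygonBraid (S.filter fun t => ¬p t) * polygonBraid (S.filter p)) := by
  obtain ⟨u, huS, hu⟩ := hp
  obtain ⟨v, hvS, hv⟩ := hnp
  have huniq : ∀ T ∈ D.partition.parts, ∀ x ∈ S, x ∈ T → T = S := fun T hT x hx hx' =>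
    D.partition.eq_of_mem_parts hT hS hx' hx
  have hq1 : S.filter p ∉ D.partition.parts.erase S := fun h =>
    Finset.ne_of_mem_erase h (huniq _ (Finset.mem_of_mem_erase h) u huS
      (Finset.mem_filter.2 ⟨huS, hu⟩))
  have hq2 : (S.filter fun t => ¬p t) ∉ insert (S.filter p) (D.partition.parts.erase S) := by
    intro h
    rcases Finset.mem_insert.1 h with h | h
    · exact (Finset.mem_filter.1 (h ▸ Finset.mem_filter.2 ⟨hvS, hv⟩ : v ∈ S.filter p)).2 |> hv
    · exact Finset.ne_of_mem_erase h (huniq _ (Finset.mem_of_mem_erase h) v hvS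
        (Finset.mem_filter.2 ⟨hvS, hv⟩))
  let P : Finpartition (Finset.univ : Finset (Fin n)) := Finpartition.ofExistsUnique
    (insert (S.filter fun t => ¬p t) (insert (S.filter p) (D.partition.parts.erase S)))
    (fun _ _ => Finset.subset_univ _)
    (by
      intro x _
      by_cases hx : x ∈ S
      · by_cases hpx : p x
        · refine ⟨S.filter p, ⟨by simp, Finset.mem_filter.2 ⟨hx, hpx⟩⟩, ?_⟩
          rintro T ⟨hT, hxT⟩
          simp only [Finset.mem_insert, Finset.mem_erase] at hT
          rcases hT with rfl | rfl | ⟨hne, hT⟩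
          · exact absurd hpx (Finset.mem_filter.1 hxT).2
          · rfl
          · exact absurd (huniq T hT x hx hxT) hne
        · refine ⟨S.filter fun t => ¬p t, ⟨by simp, Finset.mem_filter.2 ⟨hx, hpx⟩⟩, ?_⟩
          rintro T ⟨hT, hxT⟩
          simp only [Finset.mem_insert, Finset.mem_erase] at hT
          rcases hT with rfl | rfl | ⟨hne, hT⟩
          · rfl
          · exact absurd (Finset.mem_filter.1 hxT).2 hpx
          · exact absurd (huniq T hT x hx hxT) hne
      · have hT := D.partition.part_mem.2 (Finset.mem_univ x)
        have hxT := D.partition.mem_part_self.2 (Finset.mem_univ x)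
        refine ⟨D.partition.part x, ⟨?_, hxT⟩, ?_⟩
        · simp only [Finset.mem_insert, Finset.mem_erase]
          exact .inr (.inr ⟨fun h => hx (h ▸ hxT), hT⟩)
        · rintro T ⟨hT', hxT'⟩
          simp only [Finset.mem_insert, Finset.mem_erase] at hT'
          rcases hT' with rfl | rfl | ⟨hne, hT'⟩
          · exact absurd (Finset.mem_filter.1 hxT').1 hx
          · exact absurd (Finset.mem_filter.1 hxT').1 hx
          · exact D.partition.eq_of_mem_parts hT' hT hxT' hxT)
    (by
      simp only [Finset.mem_insert, Finset.mem_erase, not_or]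
      refine ⟨fun h => ?_, fun h => ?_, fun h => D.partition.bot_notMem h.2⟩
      · exact Finset.notMem_empty v (h ▸ Finset.mem_filter.2 ⟨hvS, hv⟩)
      · exact Finset.notMem_empty u (h ▸ Finset.mem_filter.2 ⟨huS, hu⟩))
  have hP : P.parts =
      insert (S.filter fun t => ¬p t) (insert (S.filter p) (D.partition.parts.erase S)) := rfl
  have hnc : ∀ A ∈ P.parts, ∀ B ∈ P.parts, ∀ a b c d : Fin n,
      a < b → b < c → c < d → a ∈ A → c ∈ A → b ∈ B → d ∈ B → A = B := by
    -- Each new block lies in an old one, so a crossing could only occur between the two pieces of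
    -- `S`.
    have key : ∀ A ∈ P.parts, ∃ A' ∈ D.partition.parts, A ⊆ A' ∧ (A' ≠ S → A = A') ∧
        (A' = S → A = (S.filter fun t => ¬p t) ∨ A = S.filter p) := by
      intro A hA
      rw [hP] at hA
      simp only [Finset.mem_insert, Finset.mem_erase] at hA
      rcases hA with rfl | rfl | ⟨hne, hA⟩
      · exact ⟨S, hS, Finset.filter_subset _ _, fun h => absurd rfl h, fun _ => .inl rfl⟩
      · exact ⟨S, hS, Finset.filter_subset _ _, fun h => absurd rfl h, fun _ => .inr rfl⟩
      · exact ⟨A, hA, subset_rfl, fun _ => rfl, fun h => absurd h hne⟩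
    intro A hA B hB a b c d hab hbc hcd ha hc hb hd
    obtain ⟨A', hA', hAA', hA1, hA2⟩ := key A hA
    obtain ⟨B', hB', hBB', hB1, hB2⟩ := key B hB
    have h := D.nonCrossing A' hA' B' hB' a b c d hab hbc hcd (hAA' ha) (hAA' hc) (hBB' hb)
      (hBB' hd)
    subst h
    by_cases hAS : A' = S
    · have hx := hcross a b c d hab hbc hcd
      rcases hA2 hAS with rfl | rfl <;> rcases hB2 hAS with rfl | rfl <;>
        simp only [Finset.mem_filter] at ha hb hc hd
      · rfl
      · exact absurd ⟨ha.2, hb.2, hc.2, hd.2⟩ hx.2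
      · exact absurd ⟨ha.2, hb.2, hc.2, hd.2⟩ hx.1
      · rfl
    · rw [hA1 hAS, hB1 hAS]
  let E : Diagram n := ⟨P, hnc⟩
  have hc := D.commute
  have hcE := E.commute
  rw [show E.partition.parts = _ from hP] at hcE
  have hR := (D.commute.mono (Finset.coe_subset.2 (Finset.erase_subset S D.partition.parts)))
  refine ⟨E, hP, (D.partition.parts.erase S).noncommProd polygonBraid hR, ?_, ?_, ?_, ?_⟩
  · exact (Finset.mul_noncommProd_erase _ hS _ hc).symm
  · exact (Finset.noncommProd_erase_mul _ hS _ hc).symm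
  · have : E.braid = (insert (S.filter fun t => ¬p t)
        (insert (S.filter p) (D.partition.parts.erase S))).noncommProd polygonBraid hcE := rfl
    rw [this, Finset.noncommProd_insert_of_notMem _ _ _ _ hq2,
      Finset.noncommProd_insert_of_notMem _ _ _ _ hq1, mul_assoc]
  · have : E.braid = (insert (S.filter fun t => ¬p t)
        (insert (S.filter p) (D.partition.parts.erase S))).noncommProd polygonBraid hcE := rfl
    have hcomm : Commute (polygonBraid (S.filter fun t => ¬p t)) (polygonBraid (S.filter p)) := by
      refine hcE (x := S.filter fun t => ¬p t) (by simp) (y := S.filter p)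
        (by simp) fun h => hq2 ?_
      rw [h]; simp
    rw [this, Finset.noncommProd_insert_of_notMem' _ _ _ _ hq2,
      Finset.noncommProd_insert_of_notMem' _ _ _ _ hq1, mul_assoc, hcomm.eq]

theorem Diagram.exists_split_right (D : Diagram n) {S : Finset (Fin n)}
    (hS : S ∈ D.partition.parts) {i j : Fin n} (hi : i ∈ S) (hj : j ∈ S) (hij : i < j) :
    ∃ E : Diagram n, E.partition.parts = insert (S.filter fun t => ¬(i ≤ t ∧ t < j))
        (insert (S.filter fun t => i ≤ t ∧ t < j) (D.partition.parts.erase S)) ∧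
      D.braid = E.braid * band i j := by
  obtain ⟨E, hE, R, -, h1, -, h2⟩ := D.exists_split hS (fun t => i ≤ t ∧ t < j)
    ⟨i, hi, le_rfl, hij⟩ ⟨j, hj, fun h => lt_irrefl _ h.2⟩ (by grind)
  exact ⟨E, hE, by rw [h1, h2, polygonBraid_split_right hi hj hij]; simp only [mul_assoc]⟩

theorem Diagram.exists_split_left (D : Diagram n) {S : Finset (Fin n)}
    (hS : S ∈ D.partition.parts) {i j : Fin n} (hi : i ∈ S) (hj : j ∈ S) (hij : i < j) :
    ∃ E : Diagram n, D.braid = band i j * E.braid := by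
  obtain ⟨E, -, R, h1, -, h2, -⟩ := D.exists_split hS (fun t => i < t ∧ t ≤ j)
    ⟨j, hj, hij, le_rfl⟩ ⟨i, hi, fun h => lt_irrefl _ h.1⟩ (by grind)
  exact ⟨E, by rw [h1, h2, polygonBraid_split_left hi hj hij]; simp only [mul_assoc]⟩

/-! ### Permutation and exponent sum -/

/-- The permutation of a braid. -/
def permHom (n : ℕ) : Braid n →* Equiv.Perm (Fin n) :=
  PresentedGroup.toGroup (f := fun p : BandIndex n => Equiv.swap p.1.1 p.1.2) (by
    rintro r (⟨i, j, k, hij, hjk, rfl | rfl⟩ | ⟨i, j, k, l, hij, hjk, hkl, rfl | rfl⟩) <;>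
      simp only [letter, map_mul, map_inv, FreeGroup.lift_apply_of, mul_inv_eq_one] <;>
      ext x <;>
      simp only [Equiv.Perm.mul_apply, Equiv.swap_apply_def] <;>
      grind)

theorem permHom_band {i j : Fin n} (h : i < j) : permHom n (band i j) = Equiv.swap i j := by
  rw [band_of_lt h]
  exact PresentedGroup.toGroup.of _

/-- The exponent sum of a braid. -/
def lenHom (n : ℕ) : Braid n →* Multiplicative ℤ :=
  PresentedGroup.toGroup (f := fun _ : BandIndex n => Multiplicative.ofAdd (1 : ℤ)) (by
    rintro r (⟨i, j, k, hij, hjk, rfl | rfl⟩ | ⟨i, j, k, l, hij, hjk, hkl, rfl | rfl⟩) <;>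
      simp [letter])

theorem lenHom_band {i j : Fin n} (h : i < j) :
    lenHom n (band i j) = Multiplicative.ofAdd (1 : ℤ) := by
  rw [band_of_lt h]
  exact PresentedGroup.toGroup.of _

/-- The positive braid of a word in the band generators. -/
def wordBraid (w : List (BandIndex n)) : Braid n := (w.map fun p => band p.1.1 p.1.2).prod

@[simp] theorem wordBraid_nil : wordBraid ([] : List (BandIndex n)) = 1 := rfl

@[simp] theorem wordBraid_cons (p : BandIndex n) (w : List (BandIndex n)) :
    wordBraid (p :: w) = band p.1.1 p.1.2 * wordBraid w := by simp [wordBraid]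

@[simp] theorem wordBraid_append (v w : List (BandIndex n)) :
    wordBraid (v ++ w) = wordBraid v * wordBraid w := by simp [wordBraid]

theorem band_mem_positive (i j : Fin n) : band i j ∈ positive n := by
  by_cases h : i < j
  · exact Submonoid.subset_closure ⟨i, j, h, rfl⟩
  · simp [band, h, one_mem]

theorem exists_word {X : Braid n} (hX : X ∈ positive n) : ∃ w, X = wordBraid w := by
  induction hX using Submonoid.closure_induction with
  | mem x hx =>
    obtain ⟨i, j, h, rfl⟩ := hx
    exact ⟨[⟨(i, j), h⟩], by simp⟩
  | one => exact ⟨[], rfl⟩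
  | mul x y _ _ hx hy =>
    obtain ⟨v, rfl⟩ := hx
    obtain ⟨w, rfl⟩ := hy
    exact ⟨v ++ w, by simp⟩

theorem polygonBraid_mem_positive (S : Finset (Fin n)) : polygonBraid S ∈ positive n := by
  refine Submonoid.list_prod_mem _ fun x hx => ?_
  obtain ⟨i, _, j, _, rfl⟩ := mem_polygon hx
  exact band_mem_positive i j

theorem Diagram.braid_mem_positive (D : Diagram n) : D.braid ∈ positive n :=
  Submonoid.noncommProd_mem _ _ _ _ fun S _ => polygonBraid_mem_positive S

theorem lenHom_wordBraid (w : List (BandIndex n)) :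
    lenHom n (wordBraid w) = Multiplicative.ofAdd (w.length : ℤ) := by
  induction w with
  | nil => simp
  | cons p w ih =>
    rw [wordBraid_cons, map_mul, ih, lenHom_band p.2, ← ofAdd_add]
    simp [add_comm]

theorem lenHom_chainBraid {a : Fin n} {l : List (Fin n)} (h : (a :: l).Pairwise (· > ·)) :
    lenHom n (chainBraid (a :: l)) = Multiplicative.ofAdd (l.length : ℤ) := by
  induction l generalizing a with
  | nil => simp
  | cons b l ih =>
    have h' := List.pairwise_cons.1 h
    rw [chainBraid_cons_cons, map_mul, ih h'.2, lenHom_band (h'.1 b (by simp)), ← ofAdd_add]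
    simp [add_comm]

theorem permHom_chainBraid {l : List (Fin n)} (h : l.Pairwise (· > ·)) :
    permHom n (chainBraid l) = l.formPerm := by
  induction l with
  | nil => simp
  | cons a l ih =>
    cases l with
    | nil => simp
    | cons b l =>
      have h' := List.pairwise_cons.1 h
      rw [chainBraid_cons_cons, map_mul, ih h'.2, permHom_band (h'.1 b (by simp)),
        List.formPerm_cons_cons, Equiv.swap_comm]

theorem lenHom_polygonBraid {S : Finset (Fin n)} (hS : S.Nonempty) :
    lenHom n (polygonBraid S) = Multiplicative.ofAdd ((S.card : ℤ) - 1) := by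
  have h : (S.sort (· ≥ ·)).Pairwise (· > ·) := S.sortedGT_sort.pairwise
  have hl := S.length_sort (· ≥ ·)
  rw [polygonBraid_eq]
  cases hs : S.sort (· ≥ ·) with
  | nil =>
    rw [hs] at hl
    exact absurd hl.symm hS.card_pos.ne'
  | cons a l =>
    rw [hs] at h hl
    rw [lenHom_chainBraid h, ← hl]
    simp

theorem permHom_polygonBraid (S : Finset (Fin n)) :
    permHom n (polygonBraid S) = (S.sort (· ≥ ·)).formPerm :=
  permHom_chainBraid S.sortedGT_sort.pairwise

theorem Diagram.lenHom_braid (D : Diagram n) :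
    lenHom n D.braid = Multiplicative.ofAdd ((n : ℤ) - D.partition.parts.card) := by
  rw [Diagram.braid, Finset.map_noncommProd, Finset.noncommProd_eq_prod,
    Finset.prod_congr rfl fun S hS =>
      lenHom_polygonBraid (D.partition.nonempty_of_mem_parts hS), ← ofAdd_sum,
    Finset.sum_sub_distrib, ← Nat.cast_sum, D.partition.sum_card_parts]
  simp

/-! ### Rigidity of positive words for diagrams -/

/-- The functions that are constant on the blocks of a diagram. -/
def Diagram.blockFunctions (D : Diagram n) : Submodule ℚ (Fin n → ℚ) where
  carrier := {f | ∀ S ∈ D.partition.parts, ∀ x ∈ S, ∀ y ∈ S, f x = f y}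
  add_mem' hf hg S hS x hx y hy := congrArg₂ (· + ·) (hf S hS x hx y hy) (hg S hS x hx y hy)
  zero_mem' _ _ _ _ _ _ := rfl
  smul_mem' c _ hf S hS x hx y hy := congrArg (c • ·) (hf S hS x hx y hy)

/-- A block function is determined by its values at one representative of each block. -/
theorem Diagram.finrank_blockFunctions_le (D : Diagram n) :
    Module.finrank ℚ D.blockFunctions ≤ D.partition.parts.card := by
  choose r hr using fun S : D.partition.parts => D.partition.nonempty_of_mem_parts S.2
  have hinj : Function.Injective
      ((LinearMap.funLeft ℚ ℚ r).comp D.blockFunctions.subtype) := by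
    intro f g hfg
    ext x
    have hS := D.partition.part_mem.2 (Finset.mem_univ x)
    have hx := D.partition.mem_part_self.2 (Finset.mem_univ x)
    have h := congrFun hfg ⟨_, hS⟩
    rw [f.2 _ hS x hx _ (hr ⟨_, hS⟩), g.2 _ hS x hx _ (hr ⟨_, hS⟩)]
    exact h
  have := LinearMap.finrank_le_finrank_of_injective hinj
  simpa using this

theorem permHom_wordBraid_invariant {f : Fin n → ℚ} {w : List (BandIndex n)}
    (h : ∀ p ∈ w, f p.1.1 = f p.1.2) (x : Fin n) : f (permHom n (wordBraid w) x) = f x := by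
  induction w generalizing x with
  | nil => simp
  | cons p w ih =>
    have hp := h p (by simp)
    rw [wordBraid_cons, map_mul, permHom_band p.2, Equiv.Perm.mul_apply,
      ← ih (fun q hq => h q (by simp [hq])) x, Equiv.swap_apply_def]
    split_ifs with h1 h2
    · rw [h1, hp]
    · rw [h2, hp]
    · rfl

/-- On a block the permutation of the diagram is a single cycle through all its points, since the
other blocks fix them. -/
theorem Diagram.mem_blockFunctions_of_invariant {D : Diagram n} {f : Fin n → ℚ}
    (hf : ∀ x, f (permHom n D.braid x) = f x) : f ∈ D.blockFunctions := by
  intro S hS x hx y hy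
  set R := (D.partition.parts.erase S).noncommProd polygonBraid
    (D.commute.mono (Finset.coe_subset.2 (Finset.erase_subset S D.partition.parts)))
  have hR : ∀ z ∈ S, permHom n R z = z := by
    intro z hz
    refine Finset.noncommProd_induction _ _ _ (fun b => permHom n b z = z)
      (fun a b ha hb => by rw [map_mul, Equiv.Perm.mul_apply, hb, ha]) (by simp) fun T hT => ?_
    rw [permHom_polygonBraid]
    refine List.formPerm_apply_of_notMem fun h => ?_
    exact Finset.ne_of_mem_erase hT (D.partition.eq_of_mem_parts (Finset.mem_of_mem_erase hT) hS
      ((Finset.mem_sort _).1 h) hz)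
  have hD : D.braid = polygonBraid S * R := (Finset.mul_noncommProd_erase _ hS _ D.commute).symm
  set g := (S.sort (· ≥ ·)).formPerm
  have hg : ∀ z, f (g z) = f z := by
    intro z
    by_cases hz : z ∈ S
    · rw [← hf z, hD, map_mul, Equiv.Perm.mul_apply, hR z hz, permHom_polygonBraid]
    · rw [List.formPerm_apply_of_notMem (mt (Finset.mem_sort _).1 hz)]
  have hpow : ∀ (k : ℕ) z, f ((g ^ k) z) = f z := by
    intro k
    induction k with
    | zero => simp
    | succ k ih =>
      intro z
      rw [pow_succ, Equiv.Perm.mul_apply, ih, hg]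
  have hcyc : g.IsCycleOn (S : Set (Fin n)) := by
    have := (S.sort_nodup (· ≥ ·)).isCycleOn_formPerm
    simpa using this
  obtain ⟨k, -, hk⟩ := hcyc.exists_pow_eq hx hy
  rw [← hk, hpow]

/-- All letters of a positive word for the braid of a diagram are chords inside blocks. -/
theorem Diagram.eq_of_mem_word {D : Diagram n} {w : List (BandIndex n)}
    (hw : D.braid = wordBraid w) {f : Fin n → ℚ} (hf : f ∈ D.blockFunctions) :
    ∀ p ∈ w, f p.1.1 = f p.1.2 := by
  -- The differences of a function across the letters of `w`; the rank is at most the length of `w`.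
  let φ : (Fin n → ℚ) →ₗ[ℚ] (Fin w.length → ℚ) :=
    LinearMap.funLeft ℚ ℚ (fun k => (w.get k).1.1) - LinearMap.funLeft ℚ ℚ (fun k => (w.get k).1.2)
  have hφ : ∀ g, g ∈ LinearMap.ker φ ↔ ∀ p ∈ w, g p.1.1 = g p.1.2 := by
    intro g
    rw [LinearMap.mem_ker, funext_iff]
    simp only [φ, LinearMap.sub_apply, Pi.sub_apply, LinearMap.funLeft_apply, Pi.zero_apply,
      sub_eq_zero]
    exact (List.forall_mem_iff_get (p := fun p : BandIndex n => g p.1.1 = g p.1.2)).symm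
  have hle : LinearMap.ker φ ≤ D.blockFunctions := fun g hg =>
    D.mem_blockFunctions_of_invariant fun x => by
      rw [hw]
      exact permHom_wordBraid_invariant ((hφ g).1 hg) x
  have hlen : (w.length : ℤ) = n - D.partition.parts.card :=
    Multiplicative.ofAdd.injective (by rw [← lenHom_wordBraid, ← hw, D.lenHom_braid])
  have h1 := D.finrank_blockFunctions_le
  have h2 := LinearMap.finrank_range_add_finrank_ker φ
  have h3 := (LinearMap.range φ).finrank_le
  simp only [Module.finrank_fintype_fun_eq_card, Fintype.card_fin] at h2 h3
  -- By rank-nullity the kernel has dimension at least `n - w.length`, the number of blocks, which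
  -- bounds the dimension of the block functions.
  have := Submodule.eq_of_le_of_finrank_le hle (by omega)
  exact (hφ f).1 (this ▸ hf)

theorem Diagram.indicator_mem (D : Diagram n) {S : Finset (Fin n)} (hS : S ∈ D.partition.parts) :
    (fun x => if x ∈ S then (1 : ℚ) else 0) ∈ D.blockFunctions := by
  intro T hT x hx y hy
  by_cases h : T = S
  · subst h; simp [hx, hy]
  · have hd : Disjoint T S := D.partition.disjoint hT hS h
    simp [Finset.disjoint_left.1 hd hx, Finset.disjoint_left.1 hd hy]

theorem Diagram.exists_block_of_mem_word {D : Diagram n} {w : List (BandIndex n)}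
    (hw : D.braid = wordBraid w) {p : BandIndex n} (hp : p ∈ w) :
    ∃ S ∈ D.partition.parts, p.1.1 ∈ S ∧ p.1.2 ∈ S := by
  have hS := D.partition.part_mem.2 (Finset.mem_univ p.1.1)
  have hx := D.partition.mem_part_self.2 (Finset.mem_univ p.1.1)
  refine ⟨_, hS, hx, ?_⟩
  have := D.eq_of_mem_word hw (D.indicator_mem hS) p hp
  by_contra h
  simp [hx, h] at this

/-! ### Factors of diagrams are diagrams -/

theorem Diagram.exists_of_word_mul {D : Diagram n} {v w : List (BandIndex n)}
    (h : D.braid = wordBraid v * wordBraid w) : ∃ E : Diagram n, E.braid = wordBraid w := by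
  induction v generalizing D with
  | nil => exact ⟨D, by simpa using h⟩
  | cons p v ih =>
    obtain ⟨S, hS, h1, h2⟩ := D.exists_block_of_mem_word (w := p :: v ++ w) (p := p)
      (by rw [h, wordBraid_append]) (by simp)
    obtain ⟨E, hE⟩ := D.exists_split_left hS h1 h2 p.2
    refine ih (D := E) (mul_left_cancel (a := band p.1.1 p.1.2) ?_)
    rw [← hE, h, wordBraid_cons, mul_assoc]

theorem Diagram.exists_of_mul_word {D : Diagram n} {v w : List (BandIndex n)}
    (h : D.braid = wordBraid v * wordBraid w) : ∃ E : Diagram n, E.braid = wordBraid v := by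
  induction w using List.reverseRecOn generalizing D with
  | nil => exact ⟨D, by simpa using h⟩
  | append_singleton w p ih =>
    obtain ⟨S, hS, h1, h2⟩ := D.exists_block_of_mem_word (w := v ++ (w ++ [p])) (p := p)
      (by rw [h, ← wordBraid_append]) (by simp)
    obtain ⟨E, -, hE⟩ := D.exists_split_right hS h1 h2 p.2
    refine ih (D := E) (mul_right_cancel (b := band p.1.1 p.1.2) ?_)
    rw [← hE, h, wordBraid_append, wordBraid_cons, wordBraid_nil, mul_one, mul_assoc]

/-- Words for `D` and `Q` concatenate to one for `E`, so by rigidity the letters of `D` are chords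
in blocks of `E`. Block functions of `E` are then invariant under the permutation of `D`, and the
indicators of the blocks of `E` give the refinement. -/
theorem Diagram.le_of_braid_mul_eq {D E : Diagram n} {Q : Braid n} (hQ : Q ∈ positive n)
    (h : D.braid * Q = E.braid) : D.partition ≤ E.partition := by
  obtain ⟨v, hv⟩ := exists_word D.braid_mem_positive
  obtain ⟨w, rfl⟩ := exists_word hQ
  have hle : E.blockFunctions ≤ D.blockFunctions := fun f hf =>
    D.mem_blockFunctions_of_invariant fun x => by
      rw [hv]
      refine permHom_wordBraid_invariant (fun p hp => ?_) x
      exact E.eq_of_mem_word (w := v ++ w) (by rw [← h, hv, wordBraid_append]) hf p (by simp [hp])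
  intro S hS
  obtain ⟨x, hx⟩ := D.partition.nonempty_of_mem_parts hS
  have hT := E.partition.part_mem.2 (Finset.mem_univ x)
  have hxT := E.partition.mem_part_self.2 (Finset.mem_univ x)
  refine ⟨_, hT, fun y hy => ?_⟩
  have := hle (E.indicator_mem hT) S hS x hx y hy
  by_contra hyT
  simp [hxT, show y ∉ E.partition.part x from hyT] at this

theorem Diagram.braid_injective : Function.Injective (Diagram.braid : Diagram n → Braid n) := by
  intro D E h
  ext1
  exact le_antisymm (Diagram.le_of_braid_mul_eq (one_mem _) (by rw [mul_one, h]))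
    (Diagram.le_of_braid_mul_eq (one_mem _) (by rw [mul_one, h]))

/-! ### Separating punctures by chords -/

/-- The angle of the `k`-th puncture. -/
noncomputable def angle (k : Fin n) : ℝ := -Real.pi + (2 * (k : ℝ) + 1) * Real.pi / (n : ℝ)

theorem angle_strictMono : StrictMono (angle : Fin n → ℝ) := by
  intro a b h
  have hn : (0 : ℝ) < n := by exact_mod_cast a.pos
  have hab : (a : ℝ) < b := by exact_mod_cast h
  unfold angle
  have := Real.pi_pos
  gcongr

theorem angle_sub_lt (a b : Fin n) : angle a - angle b < 2 * Real.pi := by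
  have hn : (0 : ℝ) < n := by exact_mod_cast a.pos
  have ha : (a : ℝ) + 1 ≤ n := by exact_mod_cast a.2
  have hb : (0 : ℝ) ≤ b := by positivity
  have hp := Real.pi_pos
  have : angle a - angle b = 2 * ((a : ℝ) - b) * Real.pi / n := by unfold angle; ring
  rw [this, div_lt_iff₀ hn]
  nlinarith

theorem sin_half_angle_pos {a b : Fin n} (h : a < b) : 0 < Real.sin ((angle b - angle a) / 2) :=
  Real.sin_pos_of_pos_of_lt_pi (by linarith [angle_strictMono h])
    (by linarith [angle_sub_lt b a])

/-- The linear functional whose level line passes through the punctures `a` and `b`. -/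
noncomputable def chordForm (a b : Fin n) : ℂ →ₗ[ℝ] ℝ :=
  Complex.reLm ∘ₗ LinearMap.mulLeft ℝ
    -- The factor 2 cancels the radius 1/2, so that the value at a puncture is a cosine.
    (2 * Complex.exp ((-((angle a + angle b) / 2) : ℝ) * Complex.I))

theorem chordForm_puncture (a b c : Fin n) :
    chordForm a b (puncture c) = Real.cos (angle c - (angle a + angle b) / 2) := by
  have : (2 * Complex.exp ((-((angle a + angle b) / 2) : ℝ) * Complex.I)) * puncture c =
      Complex.exp ((angle c - (angle a + angle b) / 2 : ℝ) * Complex.I) := by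
    unfold puncture
    rw [mul_mul_mul_comm, ← Complex.exp_add, ← add_mul, ← Complex.ofReal_add]
    norm_num
    congr 3
    unfold angle
    push_cast
    ring
  simp only [chordForm, LinearMap.comp_apply, LinearMap.mulLeft_apply, this]
  exact Complex.exp_ofReal_mul_I_re _

/-- In factored form the sign can be read off: half-differences of angles lie strictly between `-π`
and `π`, so each sine has the sign given by the order of the indices. For `a = b` the level line is
the tangent at `a`. -/
theorem chordForm_sub (a b c : Fin n) :
    chordForm a b (puncture c) - Real.cos ((angle b - angle a) / 2) =
      -2 * Real.sin ((angle c - angle a) / 2) * Real.sin ((angle c - angle b) / 2) := by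
  rw [chordForm_puncture, Real.cos_sub_cos]
  ring_nf

theorem sin_half_angle_neg {a b : Fin n} (h : a < b) : Real.sin ((angle a - angle b) / 2) < 0 := by
  have := sin_half_angle_pos h
  rw [show (angle a - angle b) / 2 = -((angle b - angle a) / 2) by ring, Real.sin_neg]
  linarith

theorem lt_chordForm {a b c : Fin n} (ha : a < c) (hb : c < b) :
    Real.cos ((angle b - angle a) / 2) < chordForm a b (puncture c) := by
  have := chordForm_sub a b c
  have h := mul_pos_of_neg_of_neg (sin_half_angle_neg hb) (neg_neg_of_pos (sin_half_angle_pos ha))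
  linarith

theorem chordForm_lt {a b c : Fin n} (hab : a ≤ b) (h : c < a ∨ b < c) :
    chordForm a b (puncture c) < Real.cos ((angle b - angle a) / 2) := by
  have := chordForm_sub a b c
  rcases h with h | h
  · have := mul_pos_of_neg_of_neg (sin_half_angle_neg h) (sin_half_angle_neg (h.trans_le hab))
    linarith
  · have := mul_pos (sin_half_angle_pos h) (sin_half_angle_pos (hab.trans_lt h))
    linarith

theorem chordForm_left (a b : Fin n) :
    chordForm a b (puncture a) = Real.cos ((angle b - angle a) / 2) := by
  have := chordForm_sub a b a
  simp at this
  linarith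

theorem chordForm_right (a b : Fin n) :
    chordForm a b (puncture b) = Real.cos ((angle b - angle a) / 2) := by
  have := chordForm_sub a b b
  simp at this
  linarith

theorem le_chordForm {a b c : Fin n} (ha : a ≤ c) (hb : c ≤ b) :
    Real.cos ((angle b - angle a) / 2) ≤ chordForm a b (puncture c) := by
  rcases ha.eq_or_lt with rfl | ha
  · exact (chordForm_left _ _).ge
  rcases hb.eq_or_lt with rfl | hb
  · exact (chordForm_right _ _).ge
  exact (lt_chordForm ha hb).le

theorem chordForm_le {a b c : Fin n} (hab : a ≤ b) (h : c ≤ a ∨ b ≤ c) :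
    chordForm a b (puncture c) ≤ Real.cos ((angle b - angle a) / 2) := by
  rcases h with h | h
  · rcases h.eq_or_lt with rfl | h
    · exact (chordForm_left _ _).le
    · exact (chordForm_lt hab (.inl h)).le
  · rcases h.eq_or_lt with rfl | h
    · exact (chordForm_right _ _).le
    · exact (chordForm_lt hab (.inr h)).le

/-! ### Inclusion of hulls is refinement -/

/-- The filled polygon with vertex set `S`. -/
noncomputable def hull (S : Finset (Fin n)) : Set ℂ :=
  convexHull ℝ (puncture '' (S : Set (Fin n)))

/-- One inequality is weak because the separating line passes through vertices of one of the
polygons. -/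
theorem disjoint_hull_of_form {S T : Finset (Fin n)} (g : ℂ →ₗ[ℝ] ℝ) (r : ℝ)
    (hS : ∀ s ∈ S, g (puncture s) < r) (hT : ∀ t ∈ T, r ≤ g (puncture t)) :
    Disjoint (hull S) (hull T) := by
  have h1 : hull S ⊆ {z | g z < r} :=
    convexHull_min (by rintro _ ⟨s, hs, rfl⟩; exact hS s hs) (convex_halfSpace_lt g.isLinear r)
  have h2 : hull T ⊆ {z | r ≤ g z} :=
    convexHull_min (by rintro _ ⟨s, hs, rfl⟩; exact hT s hs) (convex_halfSpace_ge g.isLinear r)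
  refine Set.disjoint_left.2 fun z hz hz' => ?_
  have h1' : g z < r := h1 hz
  have h2' : r ≤ g z := h2 hz'
  exact h1'.not_ge h2'

/-- The tangent at `s`, the degenerate chord, separates `s` from all other punctures. -/
theorem mem_of_puncture_mem_hull {S : Finset (Fin n)} {s : Fin n} (h : puncture s ∈ hull S) :
    s ∈ S := by
  by_contra hs
  have := disjoint_hull_of_form (S := S) (T := {s}) (chordForm s s) _
    (fun t ht => chordForm_lt le_rfl (lt_or_gt_of_ne (ne_of_mem_of_not_mem ht hs)))
    (fun t ht => le_chordForm (Finset.mem_singleton.1 ht).ge (Finset.mem_singleton.1 ht).le)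
  exact Set.disjoint_left.1 this h (subset_convexHull _ _ ⟨s, by simp, rfl⟩)

theorem Diagram.disjoint_hull (D : Diagram n) {S T : Finset (Fin n)} (hS : S ∈ D.partition.parts)
    (hT : T ∈ D.partition.parts) (hST : S ≠ T) : Disjoint (hull S) (hull T) := by
  have hne : ∀ a ∈ S, ∀ b ∈ T, a ≠ b := fun a ha b hb hab =>
    Finset.disjoint_left.1 (D.partition.disjoint hS hT hST) ha (hab ▸ hb)
  have hSn := D.partition.nonempty_of_mem_parts hS
  by_cases h : ∃ t ∈ T, S.min' hSn < t ∧ t < S.max' hSn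
  · obtain ⟨t, ht, h1, h2⟩ := h
    -- Here `a` and `b` are the neighbours of `t` in `S`. As the blocks do not cross, all of `T`
    -- lies between them, and the chord `ab` separates.
    have hA : (S.filter (· < t)).Nonempty :=
      ⟨_, Finset.mem_filter.2 ⟨S.min'_mem hSn, h1⟩⟩
    have hB : (S.filter (t < ·)).Nonempty :=
      ⟨_, Finset.mem_filter.2 ⟨S.max'_mem hSn, h2⟩⟩
    set a := (S.filter (· < t)).max' hA with ha
    set b := (S.filter (t < ·)).min' hB with hb
    obtain ⟨haS, hat⟩ := Finset.mem_filter.1 ((S.filter (· < t)).max'_mem hA)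
    obtain ⟨hbS, htb⟩ := Finset.mem_filter.1 ((S.filter (t < ·)).min'_mem hB)
    rw [← ha] at haS hat
    rw [← hb] at hbS htb
    have hS' : ∀ s ∈ S, s ≤ a ∨ b ≤ s := fun s hs =>
      (lt_or_gt_of_ne (hne s hs t ht)).imp
        (fun h => Finset.le_max' _ _ (Finset.mem_filter.2 ⟨hs, h⟩))
        (fun h => Finset.min'_le _ _ (Finset.mem_filter.2 ⟨hs, h⟩))
    have hT' : ∀ x ∈ T, a < x ∧ x < b := by
      refine fun x hx => ⟨lt_of_not_ge fun h => hST ?_, lt_of_not_ge fun h => hST ?_⟩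
      · exact (D.nonCrossing T hT S hS x a t b (lt_of_le_of_ne h (hne a haS x hx).symm) hat htb
          hx ht haS hbS).symm
      · exact D.nonCrossing S hS T hT a t b x hat htb (lt_of_le_of_ne h (hne b hbS x hx))
          haS hbS ht hx
    have := disjoint_hull_of_form (S := T) (T := S) (-chordForm a b) _
      (fun x hx => neg_lt_neg (lt_chordForm (hT' x hx).1 (hT' x hx).2))
      (fun s hs => neg_le_neg (chordForm_le (hat.trans htb).le (hS' s hs)))
    exact this.symm
  · push Not at h
    -- Now `T` avoids the range from the minimum to the maximum of `S`, so the chord joining these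
    -- two separates.
    refine (disjoint_hull_of_form (S := T) (T := S) (chordForm (S.min' hSn) (S.max' hSn)) _
      (fun t ht => chordForm_lt (S.min'_le _ (S.max'_mem hSn)) ?_)
      (fun s hs => le_chordForm (S.min'_le s hs) (S.le_max' s hs))).symm
    rcases lt_or_gt_of_ne (hne _ (S.min'_mem hSn) t ht) with h' | h'
    · exact .inr (lt_of_le_of_ne (h t ht h') (hne _ (S.max'_mem hSn) t ht))
    · exact .inl h'

theorem isClosed_hull (S : Finset (Fin n)) : IsClosed (hull S) :=
  ((S.finite_toSet.image _).isCompact_convexHull ℝ).isClosed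

/-- The hull of `S` is connected and covered by finitely many disjoint closed hulls, hence lies in
one of them. -/
theorem Diagram.exists_subset_of_hull_subset (D : Diagram n) {S : Finset (Fin n)}
    (hS : S.Nonempty) (h : hull S ⊆ D.cvh) : ∃ T ∈ D.partition.parts, S ⊆ T := by
  obtain ⟨s, hs⟩ := hS
  have hsS : puncture s ∈ hull S := subset_convexHull _ _ ⟨s, hs, rfl⟩
  have hmem := h hsS
  simp only [Diagram.cvh, Set.mem_iUnion] at hmem
  obtain ⟨T, ⟨hT, -⟩, hsT⟩ := hmem
  refine ⟨T, hT, ?_⟩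
  have hpre : IsPreconnected (hull S) := (convex_convexHull ℝ _).isPreconnected
  have hcl : IsClosed (⋃ R ∈ D.partition.parts.erase T, hull R) :=
    (D.partition.parts.erase T).finite_toSet.isClosed_biUnion fun R _ => isClosed_hull R
  have hd : ∀ z ∈ hull T, z ∉ ⋃ R ∈ D.partition.parts.erase T, hull R := by
    intro z hz hz'
    simp only [Set.mem_iUnion] at hz'
    obtain ⟨R, hR, hzR⟩ := hz'
    exact Set.disjoint_left.1 (D.disjoint_hull (Finset.mem_of_mem_erase hR) hT
      (Finset.ne_of_mem_erase hR)) hzR hz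
  have hcov : hull S ⊆ hull T ∪ ⋃ R ∈ D.partition.parts.erase T, hull R := by
    intro z hz
    have := h hz
    simp only [Diagram.cvh, Set.mem_iUnion] at this
    obtain ⟨R, ⟨hR, -⟩, hzR⟩ := this
    by_cases hRT : R = T
    · exact .inl (hRT ▸ hzR)
    · exact .inr (Set.mem_biUnion (Finset.mem_coe.2 (Finset.mem_erase.2 ⟨hRT, hR⟩)) hzR)
  rcases isPreconnected_iff_subset_of_disjoint_closed.1 hpre _ _ (isClosed_hull T) hcl hcov
    (Set.eq_empty_of_forall_notMem fun z hz => hd z hz.2.1 hz.2.2) with h' | h'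
  · exact fun x hx => mem_of_puncture_mem_hull (h' (subset_convexHull _ _ ⟨x, hx, rfl⟩))
  · exact absurd (h' hsS) (hd _ hsT)

theorem Diagram.cvh_subset_iff (D E : Diagram n) :
    D.cvh ⊆ E.cvh ↔ D.partition ≤ E.partition := by
  constructor
  · intro h S hS
    have hne := D.partition.nonempty_of_mem_parts hS
    -- An isolated dot is invisible in `cvh`, but it lies in some block of `E` anyway.
    rcases Nat.lt_or_ge S.card 2 with hc | hc
    · obtain ⟨s, hs⟩ := hne
      refine ⟨E.partition.part s, E.partition.part_mem.2 (Finset.mem_univ s), fun x hx => ?_⟩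
      rw [Finset.card_le_one.1 (Nat.le_of_lt_succ hc) x hx s hs]
      exact E.partition.mem_part_self.2 (Finset.mem_univ s)
    · refine E.exists_subset_of_hull_subset hne (subset_trans ?_ h)
      exact Set.subset_biUnion_of_mem (u := fun S => hull S)
        (show S ∈ {S | S ∈ D.partition.parts ∧ 2 ≤ S.card} from ⟨hS, hc⟩)
  · intro h z hz
    simp only [Diagram.cvh, Set.mem_iUnion] at hz ⊢
    obtain ⟨S, ⟨hS, hc⟩, hz⟩ := hz
    obtain ⟨T, hT, hST⟩ := h hS
    exact ⟨T, ⟨hT, hc.trans (Finset.card_le_card hST)⟩,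
      convexHull_mono (Set.image_mono (Finset.coe_subset.2 hST)) hz⟩

/-! ### Refinement implies divisibility -/

/-- The diagram with at most one block. -/
def Diagram.top (n : ℕ) : Diagram n where
  partition := ⊤
  nonCrossing S hS T hT _ _ _ _ _ _ _ _ _ _ _ := by
    rw [Finset.mem_singleton.1 (Finpartition.parts_top_subset _ hS),
      Finset.mem_singleton.1 (Finpartition.parts_top_subset _ hT)]

theorem Diagram.top_braid (n : ℕ) : (Diagram.top n).braid = delta n := by
  have h : (Diagram.top n).partition.parts ⊆ {Finset.univ} := Finpartition.parts_top_subset _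
  unfold Diagram.braid delta
  -- There is no block at all when `n = 0`.
  rcases Finset.subset_singleton_iff.1 h with h | h
  · have hn : (Finset.univ : Finset (Fin n)) = ∅ := by
      rw [← (Diagram.top n).partition.sup_parts, h]; rfl
    simp only [h, hn]
    rw [polygonBraid_eq, Finset.sort_empty, chainBraid_nil]
    exact Finset.noncommProd_empty _ _
  · simp only [h, Finset.noncommProd_singleton]

/-- A proper refinement of diagrams can be enlarged by splitting one block of the coarser one. -/
theorem Diagram.exists_split_of_lt {D E : Diagram n} (h : D.partition < E.partition) :
    ∃ F : Diagram n, D.partition ≤ F.partition ∧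
      E.partition.parts.card < F.partition.parts.card ∧ ∃ i j, E.braid = F.braid * band i j := by
  have hlt : ∃ T ∈ E.partition.parts, T ∉ D.partition.parts := by
    by_contra! hc
    exact h.not_ge fun T hT => ⟨T, hc T hT, le_rfl⟩
  obtain ⟨T, hT, hTD⟩ := hlt
  have hTn := E.partition.nonempty_of_mem_parts hT
  have hsub : ∀ R ∈ D.partition.parts, ∀ x ∈ R, x ∈ T → R ⊆ T := by
    intro R hR x hx hxT
    obtain ⟨T', hT', hRT'⟩ := h.le hR
    rwa [← E.partition.eq_of_mem_parts hT' hT (hRT' hx) hxT]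
  -- Taking the block `S` of `D` through the maximum of `T` ensures that every gap of `S` met by `T`
  -- is bounded above by a point of `S`.
  set M := T.max' hTn
  have hMT : M ∈ T := T.max'_mem hTn
  set S := D.partition.part M
  have hS : S ∈ D.partition.parts := D.partition.part_mem.2 (Finset.mem_univ M)
  have hMS : M ∈ S := D.partition.mem_part_self.2 (Finset.mem_univ M)
  have hST : S ⊆ T := hsub S hS M hMS hMT
  obtain ⟨x, hxT, hxS⟩ : ∃ x ∈ T, x ∉ S := by
    by_contra! hc
    exact hTD ((hST.antisymm hc) ▸ hS)
  have hxM : x < M := lt_of_le_of_ne (T.le_max' x hxT) fun h => hxS (h ▸ hMS)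
  have hJ : (S.filter (x < ·)).Nonempty := ⟨M, Finset.mem_filter.2 ⟨hMS, hxM⟩⟩
  have hI : (T.filter fun t => ∀ s ∈ S, s < x → s < t).Nonempty :=
    ⟨x, Finset.mem_filter.2 ⟨hxT, fun _ _ h => h⟩⟩
  -- The points `t` of `T` with `i ≤ t < j` will be exactly those in the gap of `S` around `x`: `j`
  -- is the upper end of the gap, and `i` the first point of `T` inside it.
  obtain ⟨j, hjS, hxj, hjmin⟩ : ∃ j ∈ S, x < j ∧ ∀ s ∈ S, x < s → j ≤ s :=
    ⟨_, (Finset.mem_filter.1 (Finset.min'_mem _ hJ)).1,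
      (Finset.mem_filter.1 (Finset.min'_mem _ hJ)).2,
      fun s hs hxs => Finset.min'_le _ _ (Finset.mem_filter.2 ⟨hs, hxs⟩)⟩
  obtain ⟨i, hiT, hi, himin⟩ : ∃ i ∈ T, (∀ s ∈ S, s < x → s < i) ∧
      ∀ t ∈ T, (∀ s ∈ S, s < x → s < t) → i ≤ t :=
    ⟨_, (Finset.mem_filter.1 (Finset.min'_mem _ hI)).1,
      (Finset.mem_filter.1 (Finset.min'_mem _ hI)).2,
      fun t ht hxt => Finset.min'_le _ _ (Finset.mem_filter.2 ⟨ht, hxt⟩)⟩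
  have hix : i ≤ x := himin x hxT fun _ _ h => h
  have hij : i < j := hix.trans_lt hxj
  have hSgap : ∀ s ∈ S, ¬(i ≤ s ∧ s < j) := by
    rintro s hs ⟨h1, h2⟩
    rcases lt_trichotomy s x with h | h | h
    · exact h1.not_gt (hi s hs h)
    · exact hxS (h ▸ hs)
    · exact h2.not_ge (hjmin s hs h)
  -- A block of `D` leaving the gap downwards would cross `S` at a point below the gap and `j`;
  -- leaving upwards, it would cross `S` at `j` and `M`. So the cut of `T` along `a_{ij}` respects
  -- `D`.
  have hgap : ∀ R ∈ D.partition.parts, R ⊆ T → ∀ r ∈ R, i ≤ r ∧ r < j →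
      ∀ r' ∈ R, i ≤ r' ∧ r' < j := by
    intro R hR hRT r hr hrij r' hr'
    have hRS : R ≠ S := fun h => hSgap r (h ▸ hr) hrij
    have hne : ∀ s ∈ S, r' ≠ s := fun s hs h =>
      hRS (D.partition.eq_of_mem_parts hR hS hr' (h ▸ hs))
    constructor
    · by_contra! hlt
      obtain ⟨s, hs, hsx, hrs⟩ : ∃ s ∈ S, s < x ∧ r' ≤ s := by
        by_contra! hc
        exact hlt.not_ge (himin r' (hRT hr') hc)
      exact hRS (D.nonCrossing R hR S hS r' s r j (lt_of_le_of_ne hrs (hne s hs))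
        ((hi s hs hsx).trans_le hrij.1) hrij.2 hr' hr hs hjS)
    · by_contra! hge
      exact hRS (D.nonCrossing R hR S hS r j r' M hrij.2 (lt_of_le_of_ne hge (hne j hjS).symm)
        (lt_of_le_of_ne (T.le_max' r' (hRT hr')) (hne M hMS)) hr hr' hjS hMS)
  obtain ⟨F, hF, hEF⟩ := E.exists_split_right hT hiT (hST hjS) hij
  refine ⟨F, ?_, ?_, i, j, hEF⟩
  · intro R hR
    rw [hF]
    obtain ⟨T', hT', hRT'⟩ := h.le hR
    by_cases hTT : T' = T
    · subst hTT
      by_cases hr : ∃ r ∈ R, i ≤ r ∧ r < j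
      · obtain ⟨r, hr, hrij⟩ := hr
        exact ⟨T'.filter fun t => i ≤ t ∧ t < j, by simp, fun r' hr' =>
          Finset.mem_filter.2 ⟨hRT' hr', hgap R hR hRT' r hr hrij r' hr'⟩⟩
      · exact ⟨T'.filter fun t => ¬(i ≤ t ∧ t < j), by simp, fun r' hr' =>
          Finset.mem_filter.2 ⟨hRT' hr', fun h => hr ⟨r', hr', h⟩⟩⟩
    · exact ⟨T', by simp [hTT, hT'], hRT'⟩
  -- Removing one letter lowers the exponent sum by one, so there is one more block; this makes the
  -- recursion below terminate.
  · have hlen := congrArg (lenHom n) hEF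
    rw [map_mul, lenHom_band hij, E.lenHom_braid, F.lenHom_braid, ← ofAdd_add] at hlen
    have := Multiplicative.ofAdd.injective hlen
    omega

theorem Diagram.exists_mul_eq_of_le {D E : Diagram n} (h : D.partition ≤ E.partition) :
    ∃ Q ∈ positive n, D.braid * Q = E.braid := by
  rcases h.eq_or_lt with h | h
  · exact ⟨1, one_mem _, by rw [mul_one, Diagram.ext h]⟩
  · obtain ⟨F, hDF, hcard, i, j, hEF⟩ := Diagram.exists_split_of_lt h
    obtain ⟨Q, hQ, hQF⟩ := Diagram.exists_mul_eq_of_le hDF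
    exact ⟨Q * band i j, mul_mem hQ (band_mem_positive i j), by rw [← mul_assoc, hQF, hEF]⟩
termination_by n - E.partition.parts.card
decreasing_by
  have : F.partition.parts.card ≤ n := by
    simpa using F.partition.card_parts_le_card
  omega

/-! ### Canonical factors -/

theorem exists_diagram_of_mem_cnFct {A : Braid n} (hA : A ∈ CnFct n) :
    ∃ D : Diagram n, D.braid = A := by
  obtain ⟨⟨P, hP, Q, hQ, rfl⟩, R, hR, S, hS, h⟩ := hA
  obtain ⟨r, rfl⟩ := exists_word hR
  obtain ⟨s, rfl⟩ := exists_word hS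
  obtain ⟨w, hw⟩ := exists_word (mul_mem (mul_mem hP (one_mem _)) hQ)
  rw [hw, ← Diagram.top_braid] at h
  rw [hw]
  obtain ⟨E, hE⟩ := Diagram.exists_of_mul_word (v := r ++ w) (w := s) (by rw [h, wordBraid_append])
  exact Diagram.exists_of_word_mul (v := r) (w := w) (by rw [hE, wordBraid_append])

theorem Diagram.prec_iff (D E : Diagram n) :
    Prec D.braid E.braid ↔ D.partition ≤ E.partition := by
  constructor
  · rintro ⟨Q, ⟨⟨P, hP, R, hR, rfl⟩, -⟩, h⟩
    exact Diagram.le_of_braid_mul_eq (mul_mem (mul_mem hP (one_mem _)) hR) h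
  · intro h
    obtain ⟨Q, hQ, hDE⟩ := Diagram.exists_mul_eq_of_le h
    -- Completing `E` to `δ` gives `δ = D.braid * Q * R`, so the quotient `Q` is itself a canonical
    -- factor.
    obtain ⟨R, hR, hE⟩ := Diagram.exists_mul_eq_of_le (E := Diagram.top n)
      (show E.partition ≤ ⊤ from le_top)
    exact ⟨Q, ⟨⟨1, one_mem _, Q, hQ, by simp⟩, D.braid, D.braid_mem_positive, R, hR,
      by rw [hDE, hE, Diagram.top_braid]⟩, hDE⟩

end BandBraid

/-- Every canonical factor of `B_n` is represented by exactly one non-crossing partition diagram (so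
that `cvh` of a canonical factor makes sense), and for canonical factors `A`, `B` we have
`cvh(A) ⊆ cvh(B)` if and only if `A ≺ B`. -/
theorem theorem3p1 (n : ℕ) :
    (∀ A ∈ BandBraid.CnFct n, ∃! D : BandBraid.Diagram n, D.braid = A) ∧
    ∀ A ∈ BandBraid.CnFct n, ∀ B ∈ BandBraid.CnFct n,
      ∀ DA DB : BandBraid.Diagram n, DA.braid = A → DB.braid = B →
        (DA.cvh ⊆ DB.cvh ↔ BandBraid.Prec A B) := by
  refine ⟨fun A hA => ?_, ?_⟩
  · obtain ⟨D, hD⟩ := BandBraid.exists_diagram_of_mem_cnFct hA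
    exact ⟨D, hD, fun E hE => BandBraid.Diagram.braid_injective (hE.trans hD.symm)⟩
  · rintro _ - _ - D E rfl rfl
    rw [D.cvh_subset_iff, D.prec_iff]
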